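/- A signed tree is a pair $(T,s)$ where $T$ is a finite tree and $s$ assigns to every edge of $T$ a sign $+$ or $-$. The signed degree $\operatorname{sdeg}(v)$ of a vertex $v$ is the number of positive edges incident to $v$ minus the number of negative edges incident to $v$. The signed tree $(T,s)$ realizes a set $D\subset\mathbb Z$ if $D=\{\operatorname{sdeg}(v) : v\in V(T)\}$. Let $\sigma(D)$ be the smallest number of vertices of a signed tree that realizes $D$, and call a signed tree that realizes $D$ optimal if it has exactly $\sigma(D)$ vertices. Theorem. Let $n\ge 0$, let $x_1,\dots,x_n$ be distinct integers with $x_i>1$ for all $i$, and let $D=\{1,0,x_1,\dots,x_n\}$. Then some signed tree realizes $D$, and $$\sigma(D)=4-n+\sum_{i=1}^n x_i .$$ Moreover, every optimal signed tree for $D$ has exactly one negative edge, and both ends of this edge have degree $2$ and signed degree $0$. -/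

import Mathlib

/-- The two possible signs of an edge. -/
inductive EdgeSign : Type
  | pos : EdgeSign
  | neg : EdgeSign

/-- A signed graph on the vertex type `V`: a simple graph together with a function that assigns
a sign to every edge. -/
structure SignedGraph (V : Type*) where
  /-- the underlying graph -/
  graph : SimpleGraph V
  /-- the sign of each edge -/
  sign : graph.edgeSet → EdgeSign

namespace SignedGraph

variable {V : Type*}

/-- The signed degree of `v`: the number of positive edges incident to `v` minus the number of
negative edges incident to `v`. (It is only used for finite vertex types.) -/
noncomputable def sdeg (S : SignedGraph V) (v : V) : ℤ :=
  ({e : S.graph.edgeSet | v ∈ (e : Sym2 V) ∧ S.sign e = EdgeSign.pos}.ncard : ℤ) -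
    ({e : S.graph.edgeSet | v ∈ (e : Sym2 V) ∧ S.sign e = EdgeSign.neg}.ncard : ℤ)

/-- The signed degree set of a signed graph. -/
def degreeSet (S : SignedGraph V) : Set ℤ := Set.range S.sdeg

/-- `S` is a signed tree that realizes `D`: its underlying graph is a tree and its signed degree
set is exactly `D`. -/
def IsTreeRealizing (S : SignedGraph V) (D : Set ℤ) : Prop :=
  S.graph.IsTree ∧ S.degreeSet = D

end SignedGraph

/-- The set of orders of (finite) signed trees that realize `D`. A finite graph of order `N` is,
up to isomorphism, a graph on `Fin N`. -/
def realizingTreeOrders (D : Set ℤ) : Set ℕ :=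
  {N | ∃ S : SignedGraph (Fin N), S.IsTreeRealizing D}

/-- The order `σ(D)`: the smallest order of a signed tree that realizes `D`. -/
noncomputable def minTreeOrder (D : Set ℤ) : ℕ := sInf (realizingTreeOrders D)

/-- `S` is an optimal signed tree for `D`: it realizes `D` and its order is `σ(D)`. -/
def SignedGraph.IsOptimalTree {V : Type*} [Fintype V] (S : SignedGraph V) (D : Set ℤ) : Prop :=
  S.IsTreeRealizing D ∧ Fintype.card V = minTreeOrder D

/-! Lower bound: in a tree the numbers `degree v - 1` sum to `|V| - 2`, and `degree = sdeg + 2 *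
negDegree`. All prescribed values are nonnegative, so a vertex `z` of signed degree 0 has a negative
edge `zw`. Vertices `u i` of signed degree `x i` contribute at least `x i - 1` each, and `z` and `w`
one more each; summing gives `order_bound`. Equality leaves no slack, so a vertex on a negative edge
must be `z` or `w`, with degree 2 and signed degree 0.

Sharpness (`exists_treeRealizable`): the path with signs `+ - +` has signed degrees 1, 0, 0, 1.
Attaching `x i - 1` positive leaves to a vertex of signed degree 1 creates `x i`, and the new leaves
again have signed degree 1. -/

namespace EdgeSign

/-- The sign as an integer. -/
def val : EdgeSign → ℤ
  | pos => 1
  | neg => -1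

end EdgeSign

namespace SignedGraph

variable {V : Type*}

/-! ### Lower bound and the case of equality -/

/-- The number of negative edges incident to a vertex. -/
noncomputable def negDegree (S : SignedGraph V) (v : V) : ℕ :=
  {e : S.graph.edgeSet | v ∈ (e : Sym2 V) ∧ S.sign e = EdgeSign.neg}.ncard

theorem negDegree_pos_iff [Finite V] (S : SignedGraph V) (v : V) :
    0 < S.negDegree v ↔ ∃ e : S.graph.edgeSet, v ∈ (e : Sym2 V) ∧ S.sign e = EdgeSign.neg := by
  rw [negDegree, Set.ncard_pos]
  rfl

theorem sdeg_add_two_mul_negDegree [Fintype V] (S : SignedGraph V) [DecidableRel S.graph.Adj]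
    (v : V) : S.sdeg v + 2 * S.negDegree v = S.graph.degree v := by
  classical
  have hdeg : {e : S.graph.edgeSet | v ∈ (e : Sym2 V)}.ncard = S.graph.degree v := by
    rw [← SimpleGraph.card_incidenceFinset_eq_degree, ← Set.ncard_coe_finset,
      ← Set.ncard_image_of_injective _ Subtype.val_injective]
    congr 1
    ext e
    simp [SimpleGraph.incidenceSet, and_comm]
  have hsplit : {e : S.graph.edgeSet | v ∈ (e : Sym2 V)} =
      {e : S.graph.edgeSet | v ∈ (e : Sym2 V) ∧ S.sign e = EdgeSign.pos} ∪
        {e : S.graph.edgeSet | v ∈ (e : Sym2 V) ∧ S.sign e = EdgeSign.neg} := by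
    ext e
    cases h : S.sign e <;> simp [h]
  have hdisj : Disjoint {e : S.graph.edgeSet | v ∈ (e : Sym2 V) ∧ S.sign e = EdgeSign.pos}
      {e : S.graph.edgeSet | v ∈ (e : Sym2 V) ∧ S.sign e = EdgeSign.neg} := by
    rw [Set.disjoint_left]
    rintro e ⟨_, h⟩ ⟨_, h'⟩
    simp [h] at h'
  rw [hsplit, Set.ncard_union_eq hdisj] at hdeg
  rw [sdeg, negDegree, ← hdeg]
  push_cast
  ring

theorem sum_degree_sub_one_of_isTree [Fintype V] (G : SimpleGraph V) [DecidableRel G.Adj]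
    (hG : G.IsTree) : ∑ v, ((G.degree v : ℤ) - 1) = Fintype.card V - 2 := by
  classical
  have h1 := G.sum_degrees_eq_twice_card_edges
  have h2 := hG.card_edgeFinset
  rw [Finset.sum_sub_distrib, ← Nat.cast_sum, h1]
  simp
  omega

/-- The lower bound for the order of a signed tree, with the structure in the case of equality. -/
theorem order_bound [Fintype V] (S : SignedGraph V) [DecidableRel S.graph.Adj]
    {n : ℕ} {x : Fin n → ℤ} (hx : ∀ i, 1 < x i) (hinj : Function.Injective x)
    (hS : S.IsTreeRealizing ({1, 0} ∪ Set.range x)) :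
    4 - (n : ℤ) + ∑ i, x i ≤ Fintype.card V ∧
    ((Fintype.card V : ℤ) = 4 - (n : ℤ) + ∑ i, x i →
      ∃ e : S.graph.edgeSet, S.sign e = EdgeSign.neg ∧
        (∀ e' : S.graph.edgeSet, S.sign e' = EdgeSign.neg → e' = e) ∧
        ∀ v ∈ (e : Sym2 V), S.graph.degree v = 2 ∧ S.sdeg v = 0) := by
  classical
  obtain ⟨htree, hD⟩ := hS
  have hmem : ∀ v, S.sdeg v = 1 ∨ S.sdeg v = 0 ∨ ∃ i, x i = S.sdeg v := by
    intro v
    have : S.sdeg v ∈ S.degreeSet := ⟨v, rfl⟩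
    rw [hD] at this
    simpa [or_assoc] using this
  have hnonneg : ∀ v, 0 ≤ S.sdeg v := by
    intro v
    rcases hmem v with h | h | ⟨i, h⟩
    · omega
    · omega
    · have := hx i
      omega
  have hsurj : ∀ d ∈ ({1, 0} ∪ Set.range x : Set ℤ), ∃ v, S.sdeg v = d := by
    intro d hd
    rw [← hD] at hd
    exact hd
  obtain ⟨o, ho⟩ := hsurj 1 (by simp)
  obtain ⟨z, hz⟩ := hsurj 0 (by simp)
  choose u hu using fun i => hsurj (x i) (by simp)
  have huinj : Function.Injective u := fun i j h => hinj (by rw [← hu, ← hu, h])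
  have hdeg := S.sdeg_add_two_mul_negDegree
  -- A one-vertex tree has signed degree 0 without any negative edge, so this case must be excluded.
  have hnontriv : Nontrivial V := ⟨o, z, fun h => by rw [h] at ho; omega⟩
  have hpos : ∀ v, 0 < S.graph.degree v := fun v =>
    htree.connected.preconnected.degree_pos_of_nontrivial v
  have hqz : 0 < S.negDegree z := by
    have := hdeg z
    have := hpos z
    omega
  obtain ⟨⟨e, he⟩, hze, hneg⟩ := (S.negDegree_pos_iff z).1 hqz
  obtain ⟨w, rfl⟩ := Sym2.mem_iff_exists.1 hze
  have hzw : z ≠ w := S.graph.ne_of_adj he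
  have hqw : 0 < S.negDegree w := (S.negDegree_pos_iff w).2 ⟨_, Sym2.mem_mk_right z w, hneg⟩
  -- `g` is a pointwise lower bound for `degree - 1`. The vertex `w` may be one of the `u i`: its
  -- negative edge forces degree at least `x i + 2`, which leaves room for the extra 1.
  let h : V → ℤ := fun v => ∑ i, if v = u i then x i - 1 else 0
  let g : V → ℤ := fun v => h v + (if v = z then 1 else 0) + (if v = w then 1 else 0)
  have hh : ∀ v, h v = 0 ∨ ∃ i, v = u i ∧ h v = x i - 1 := by
    intro v
    by_cases hv : ∃ i, v = u i
    · obtain ⟨i, rfl⟩ := hv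
      right
      exact ⟨i, rfl, by simp [h, huinj.eq_iff]⟩
    · left
      push Not at hv
      simp [h, hv]
  have hle : ∀ v, g v ≤ (S.graph.degree v : ℤ) - 1 := by
    intro v
    have h1 := hdeg v
    have h2 := hpos v
    have h3 := hnonneg v
    rcases hh v with h0 | ⟨i, hi, h0⟩
    · simp only [g, h0]
      split_ifs with ha hb hb
      · exact absurd (ha.symm.trans hb) hzw
      · rw [ha] at h1 ⊢
        omega
      · rw [hb] at h1 h3 ⊢
        omega
      · omega
    · have h4 := hu i
      rw [← hi] at h4
      have h5 := hx i
      simp only [g, h0]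
      rw [if_neg (by rintro rfl; omega)]
      split_ifs with hb
      · rw [hb] at h1 h4 ⊢
        omega
      · omega
  have hsumg : ∑ v, g v = 2 - (n : ℤ) + ∑ i, x i := by
    simp only [g, h, Finset.sum_add_distrib]
    rw [Finset.sum_comm]
    simp
    ring
  have hsum := sum_degree_sub_one_of_isTree S.graph htree
  have hsumle := Finset.sum_le_sum fun v (_ : v ∈ Finset.univ) => hle v
  refine ⟨by linarith, fun heq => ?_⟩
  have hfg : ∀ v, g v = (S.graph.degree v : ℤ) - 1 := fun v =>
    (Finset.sum_eq_sum_iff_of_le fun v _ => hle v).1 (by linarith) v (Finset.mem_univ v)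
  -- A negative edge forces `degree v ≥ sdeg v + 2`, so `g v = degree v - 1` fails at every `u i`
  -- and wherever `g v = 0`.
  have key : ∀ v, 0 < S.negDegree v →
      (v = z ∨ v = w) ∧ S.graph.degree v = 2 ∧ S.sdeg v = 0 := by
    intro v hv
    have h1 := hdeg v
    have h2 := hfg v
    have h3 := hnonneg v
    rcases hh v with h0 | ⟨i, hi, h0⟩
    · simp only [g, h0] at h2
      split_ifs at h2 with ha hb hb
      · exact absurd (ha.symm.trans hb) hzw
      · exact ⟨Or.inl ha, by omega, by omega⟩
      · exact ⟨Or.inr hb, by omega, by omega⟩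
      · omega
    · have h4 := hu i
      rw [← hi] at h4
      have h5 := hx i
      simp only [g, h0] at h2
      rw [if_neg (by rintro rfl; omega)] at h2
      split_ifs at h2 <;> omega
  refine ⟨⟨s(z, w), he⟩, hneg, ?_, ?_⟩
  · rintro ⟨e', he'⟩ hneg'
    induction e' with | _ a b
    have ha := (key a ((S.negDegree_pos_iff a).2 ⟨_, Sym2.mem_mk_left a b, hneg'⟩)).1
    have hb := (key b ((S.negDegree_pos_iff b).2 ⟨_, Sym2.mem_mk_right a b, hneg'⟩)).1
    have hab : a ≠ b := S.graph.ne_of_adj he'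
    rw [Subtype.mk.injEq, Sym2.eq_iff]
    grind
  · intro v hv
    refine (key v ?_).2
    rcases Sym2.mem_iff.1 hv with rfl | rfl
    · exact hqz
    · exact hqw

/-! ### Signed degrees as weight sums, and attaching a leaf -/

open Classical in
/-- The integer weight of a pair of vertices: the sign of the edge joining them, or zero. -/
noncomputable def weight (S : SignedGraph V) (u v : V) : ℤ :=
  if h : S.graph.Adj u v then (S.sign ⟨s(u, v), h⟩).val else 0

theorem weight_comm (S : SignedGraph V) (u v : V) : S.weight u v = S.weight v u := by
  unfold weight
  by_cases h : S.graph.Adj u v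
  · rw [dif_pos h, dif_pos h.symm]
    congr 3
    exact Sym2.eq_swap
  · rw [dif_neg h, dif_neg fun h' => h h'.symm]

theorem ncard_incident_sign (S : SignedGraph V) (v : V) (t : EdgeSign) :
    {e : S.graph.edgeSet | v ∈ (e : Sym2 V) ∧ S.sign e = t}.ncard =
      {u : V | ∃ h : S.graph.Adj v u, S.sign ⟨s(v, u), h⟩ = t}.ncard := by
  symm
  refine Set.ncard_congr (fun u hu => ⟨s(v, u), hu.1⟩) ?_ ?_ ?_
  · rintro u ⟨h, ht⟩
    exact ⟨Sym2.mem_mk_left v u, ht⟩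
  · intro a b _ _ hab
    exact Sym2.congr_right.1 (Subtype.mk.inj hab)
  · rintro ⟨e, he⟩ ⟨hve, ht⟩
    obtain ⟨u, rfl⟩ := Sym2.mem_iff_exists.1 hve
    exact ⟨u, ⟨he, ht⟩, rfl⟩

/-- A sum over vertices splits along `Option V`, which makes the effect of a new leaf computable. -/
theorem sdeg_eq_sum_weight [Fintype V] (S : SignedGraph V) (v : V) :
    S.sdeg v = ∑ u, S.weight v u := by
  classical
  have hcard : ∀ t : EdgeSign,
      ({u : V | ∃ h : S.graph.Adj v u, S.sign ⟨s(v, u), h⟩ = t}.ncard : ℤ) =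
        ∑ u, if ∃ h : S.graph.Adj v u, S.sign ⟨s(v, u), h⟩ = t then 1 else 0 := by
    intro t
    rw [Finset.sum_boole, ← Set.ncard_coe_finset]
    simp
  rw [sdeg, ncard_incident_sign, ncard_incident_sign, hcard, hcard, ← Finset.sum_sub_distrib]
  refine Finset.sum_congr rfl fun u _ => ?_
  unfold weight
  by_cases h : S.graph.Adj v u
  · cases hs : S.sign ⟨s(v, u), h⟩ <;> simp [h, hs, EdgeSign.val]
  · simp [h]

/-- The graph on `Option V` obtained by attaching the new vertex `none` to `v`. -/
def leafGraph (G : SimpleGraph V) (v : V) : SimpleGraph (Option V) where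
  Adj
    | some a, some b => G.Adj a b
    | some a, none => a = v
    | none, some b => b = v
    | none, none => False
  symm := ⟨by
    rintro (_ | a) (_ | b) h
    · exact h
    · exact h
    · exact h
    · exact G.adj_symm h⟩
  loopless := ⟨by
    rintro (_ | a) h
    · exact h
    · exact G.loopless.irrefl a h⟩

theorem leafGraph_isTree [Fintype V] {G : SimpleGraph V} (hG : G.IsTree) (v : V) :
    (leafGraph G v).IsTree := by
  classical
  rw [SimpleGraph.isTree_iff_connected_and_card] at hG ⊢
  obtain ⟨hconn, hcard⟩ := hG
  constructor
  · let f : G →g leafGraph G v := ⟨some, fun h => h⟩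
    rw [SimpleGraph.connected_iff_exists_forall_reachable]
    refine ⟨some v, ?_⟩
    rintro (_ | b)
    · exact SimpleGraph.Adj.reachable (show v = v from rfl)
    · exact (hconn.preconnected v b).map f
  · have hedge : (leafGraph G v).edgeSet =
        insert s(none, some v) (Sym2.map some '' G.edgeSet) := by
      ext e
      induction e with | _ a b
      constructor
      · intro h
        rcases a with _ | a <;> rcases b with _ | b
        · exact h.elim
        · left
          rw [show b = v from h]
        · left
          rw [show a = v from h]
          exact Sym2.eq_swap
        · right
          exact ⟨s(a, b), h, rfl⟩
      · rintro (h | ⟨e, he, h⟩)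
        · rw [h]
          exact (rfl : v = v)
        · rw [← h]
          induction e with | _ c d
          exact he
    have hnot : s(none, some v) ∉ Sym2.map some '' G.edgeSet := by
      rintro ⟨e, -, h⟩
      induction e with | _ c d
      simp at h
    rw [Nat.card_coe_set_eq] at hcard ⊢
    rw [hedge, Set.ncard_insert_of_notMem hnot,
      Set.ncard_image_of_injective _ (Sym2.map.injective (Option.some_injective V)), hcard]
    simp

open Classical in
/-- Attach a leaf to `v` by an edge of sign `t`. -/
noncomputable def addLeaf (S : SignedGraph V) (v : V) (t : EdgeSign) :
    SignedGraph (Option V) where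
  graph := leafGraph S.graph v
  sign e := if h : ∃ e' : S.graph.edgeSet, Sym2.map some (e' : Sym2 V) = e then S.sign h.choose
    else t

theorem addLeaf_weight_some_some (S : SignedGraph V) (v : V) (t : EdgeSign) (a b : V) :
    (S.addLeaf v t).weight (some a) (some b) = S.weight a b := by
  unfold weight
  by_cases hab : S.graph.Adj a b
  · have hab' : (S.addLeaf v t).graph.Adj (some a) (some b) := hab
    have hex : ∃ e' : S.graph.edgeSet, Sym2.map some (e' : Sym2 V) = s(some a, some b) :=
      ⟨⟨s(a, b), hab⟩, rfl⟩
    -- The chosen preimage is unique because `Sym2.map some` is injective.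
    have hch : hex.choose = ⟨s(a, b), hab⟩ :=
      Subtype.ext (Sym2.map.injective (Option.some_injective V) hex.choose_spec)
    rw [dif_pos hab, dif_pos hab']
    simp only [addLeaf]
    rw [dif_pos hex, hch]
  · have hab' : ¬ (S.addLeaf v t).graph.Adj (some a) (some b) := hab
    rw [dif_neg hab, dif_neg hab']

theorem addLeaf_weight_none_none (S : SignedGraph V) (v : V) (t : EdgeSign) :
    (S.addLeaf v t).weight none none = 0 := by
  simp [weight]

open Classical in
theorem addLeaf_weight_none_some (S : SignedGraph V) (v : V) (t : EdgeSign) (b : V) :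
    (S.addLeaf v t).weight none (some b) = if b = v then t.val else 0 := by
  unfold weight
  by_cases hb : b = v
  · have hb' : (S.addLeaf v t).graph.Adj none (some b) := hb
    have hex : ¬ ∃ e' : S.graph.edgeSet, Sym2.map some (e' : Sym2 V) = s(none, some b) := by
      rintro ⟨e, h⟩
      have hmem : none ∈ Sym2.map some (e : Sym2 V) := h ▸ Sym2.mem_mk_left _ _
      obtain ⟨_, _, hc⟩ := Sym2.mem_map.1 hmem
      exact Option.some_ne_none _ hc
    rw [if_pos hb, dif_pos hb']
    simp only [addLeaf]
    rw [dif_neg hex]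
  · have hb' : ¬ (S.addLeaf v t).graph.Adj none (some b) := hb
    rw [if_neg hb, dif_neg hb']

theorem addLeaf_sdeg_none [Fintype V] (S : SignedGraph V) (v : V) (t : EdgeSign) :
    (S.addLeaf v t).sdeg none = t.val := by
  classical
  simp only [sdeg_eq_sum_weight, Fintype.sum_option, addLeaf_weight_none_none,
    addLeaf_weight_none_some, zero_add]
  rw [Finset.sum_ite_eq' Finset.univ v fun _ => t.val, if_pos (Finset.mem_univ v)]

open Classical in
theorem addLeaf_sdeg_some [Fintype V] (S : SignedGraph V) (v : V) (t : EdgeSign) (a : V) :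
    (S.addLeaf v t).sdeg (some a) = S.sdeg a + if a = v then t.val else 0 := by
  simp [sdeg_eq_sum_weight, Fintype.sum_option, addLeaf_weight_some_some,
    weight_comm _ (some a) none, addLeaf_weight_none_some, add_comm]

/-! ### Realizable multisets and the extremal construction -/

/-- Some signed tree has `M` as its multiset of signed degrees. -/
def TreeRealizable (M : Multiset ℤ) : Prop :=
  ∃ (V : Type) (_ : Fintype V) (S : SignedGraph V),
    S.graph.IsTree ∧ Finset.univ.val.map S.sdeg = M

theorem treeRealizable_singleton_zero : TreeRealizable {0} := by
  refine ⟨Unit, inferInstance, ⟨⊥, fun e => EdgeSign.pos⟩, SimpleGraph.IsTree.of_subsingleton, ?_⟩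
  simp [sdeg_eq_sum_weight, weight]

theorem TreeRealizable.add_leaf {a : ℤ} {M : Multiset ℤ} (h : TreeRealizable (a ::ₘ M))
    (t : EdgeSign) : TreeRealizable ((a + t.val) ::ₘ t.val ::ₘ M) := by
  classical
  obtain ⟨V, _, S, hS, hM⟩ := h
  have ha : a ∈ Finset.univ.val.map S.sdeg := by simp [hM]
  obtain ⟨v, -, rfl⟩ := Multiset.mem_map.1 ha
  refine ⟨Option V, inferInstance, S.addLeaf v t, leafGraph_isTree hS v, ?_⟩
  have huniv : (Finset.univ : Finset V).val = v ::ₘ (Finset.univ.erase v).val := by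
    rw [Finset.erase_val, Multiset.cons_erase (Finset.mem_univ v)]
  have hrest : ((Finset.univ.erase v).val.map fun b => (S.addLeaf v t).sdeg (some b)) = M := by
    rw [huniv, Multiset.map_cons, Multiset.cons_inj_right] at hM
    rw [← hM]
    refine Multiset.map_congr rfl fun b hb => ?_
    rw [addLeaf_sdeg_some, if_neg (Finset.ne_of_mem_erase hb), add_zero]
  have hopt : (Finset.univ : Finset (Option V)).val =
      none ::ₘ (Finset.univ : Finset V).val.map some := rfl
  rw [hopt, Multiset.map_cons, Multiset.map_map, addLeaf_sdeg_none, huniv, Multiset.map_cons,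
    Multiset.cons_swap]
  simp only [Function.comp_def]
  rw [hrest, addLeaf_sdeg_some, if_pos rfl]

theorem TreeRealizable.add_pos_leaves {a : ℤ} {M : Multiset ℤ} (h : TreeRealizable (a ::ₘ M))
    (k : ℕ) : TreeRealizable ((a + k) ::ₘ (Multiset.replicate k 1 + M)) := by
  induction k with
  | zero => simpa using h
  | succ k ih =>
    have := ih.add_leaf EdgeSign.pos
    rw [Multiset.replicate_succ, Multiset.cons_add]
    push_cast
    rw [← add_assoc]
    exact this

/-- The signed graph transported along a bijection of the vertices. -/
def transport {W : Type*} (S : SignedGraph V) (f : W ≃ V) : SignedGraph W where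
  graph := S.graph.comap f
  sign e := S.sign ⟨Sym2.map f e, by
    obtain ⟨e, he⟩ := e
    induction e with | _ a b
    exact he⟩

theorem transport_sdeg {W : Type*} [Fintype V] [Fintype W] (S : SignedGraph V) (f : W ≃ V)
    (w : W) : (S.transport f).sdeg w = S.sdeg (f w) := by
  rw [sdeg_eq_sum_weight, sdeg_eq_sum_weight, ← f.sum_comp]
  rfl

theorem TreeRealizable.card_mem_realizingTreeOrders {M : Multiset ℤ} (h : TreeRealizable M) :
    M.card ∈ realizingTreeOrders {d | d ∈ M} := by
  obtain ⟨V, _, S, hS, rfl⟩ := h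
  let f : Fin (Fintype.card V) ≃ V := (Fintype.equivFin V).symm
  rw [Multiset.card_map, Finset.card_val, Finset.card_univ]
  refine ⟨S.transport f, (SimpleGraph.Iso.comap f S.graph).isTree_iff.2 hS, ?_⟩
  ext d
  simp only [degreeSet, Set.mem_range, transport_sdeg]
  rw [f.surjective.exists (p := fun v => S.sdeg v = d) |>.symm]
  simp

theorem exists_treeRealizable (n : ℕ) (x : Fin n → ℤ) (hx : ∀ i, 1 < x i) :
    ∃ M : Multiset ℤ, TreeRealizable M ∧ {d | d ∈ M} = {1, 0} ∪ Set.range x ∧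
      (M.card : ℤ) = 4 - (n : ℤ) + ∑ i, x i := by
  induction n with
  | zero =>
    have h1 : TreeRealizable {-1, -1} := treeRealizable_singleton_zero.add_leaf EdgeSign.neg
    have h2 : TreeRealizable ({0, 1, -1} : Multiset ℤ) := h1.add_leaf EdgeSign.pos
    have h3 : TreeRealizable ((-1 : ℤ) ::ₘ {0, 1}) := by
      convert h2 using 1
      decide
    have h4 : TreeRealizable ({0, 1, 0, 1} : Multiset ℤ) := h3.add_leaf EdgeSign.pos
    refine ⟨_, h4, ?_, by simp⟩
    ext d
    simp
    tauto
  | succ n ih =>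
    obtain ⟨M, hM, hset, hcard⟩ := ih (fun i => x i.castSucc) fun i => hx _
    have h1 : (1 : ℤ) ∈ M := by
      have : (1 : ℤ) ∈ {d | d ∈ M} := by simp [hset]
      exact this
    obtain ⟨M, rfl⟩ := Multiset.exists_cons_of_mem h1
    obtain ⟨k, hk⟩ := Int.eq_ofNat_of_zero_le (a := x (Fin.last n) - 1)
      (by have := hx (Fin.last n); omega)
    -- The vertex turned into `x (Fin.last n)` may have been the only one of value 1; at least one
    -- new leaf keeps 1 in the set.
    have hk0 : k ≠ 0 := by
      have := hx (Fin.last n)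
      omega
    refine ⟨_, hM.add_pos_leaves k, ?_, ?_⟩
    · ext d
      have hd := Set.ext_iff.1 hset d
      have hlast : 1 + (k : ℤ) = x (Fin.last n) := by omega
      simp only [Set.mem_ofPred_eq, Multiset.mem_cons, Multiset.mem_add, Multiset.mem_replicate,
        Set.mem_union, Set.mem_insert_iff, Set.mem_singleton_iff, Set.mem_range,
        Fin.exists_fin_succ', hlast] at hd ⊢
      have hsymm : x (Fin.last n) = d ↔ d = x (Fin.last n) := eq_comm
      tauto
    · rw [Fin.sum_univ_castSucc]
      simp only [Multiset.card_cons, Multiset.card_add, Multiset.card_replicate] at hcard ⊢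
      push_cast at hcard ⊢
      linarith

end SignedGraph

theorem mainTheorem7 (n : ℕ) (x : Fin n → ℤ) (hx : ∀ i, 1 < x i)
    (hinj : Function.Injective x) (D : Set ℤ) (hD : D = {1, 0} ∪ Set.range x) :
    IsLeast (realizingTreeOrders D) (minTreeOrder D) ∧
    (minTreeOrder D : ℤ) = 4 - (n : ℤ) + ∑ i, x i ∧
    ∀ (V : Type*) [Fintype V] (S : SignedGraph V) [DecidableRel S.graph.Adj],
      S.IsOptimalTree D →
        ∃ e : S.graph.edgeSet, S.sign e = EdgeSign.neg ∧
          (∀ e' : S.graph.edgeSet, S.sign e' = EdgeSign.neg → e' = e) ∧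
          ∀ v ∈ (e : Sym2 V), S.graph.degree v = 2 ∧ S.sdeg v = 0 := by
  classical
  subst hD
  obtain ⟨M, hM, hset, hcard⟩ := SignedGraph.exists_treeRealizable n x hx
  have hmem := hM.card_mem_realizingTreeOrders
  rw [hset] at hmem
  have hleast : IsLeast (realizingTreeOrders ({1, 0} ∪ Set.range x)) M.card := by
    refine ⟨hmem, ?_⟩
    rintro N ⟨S, hS⟩
    have := (S.order_bound hx hinj hS).1
    rw [← hcard, Fintype.card_fin] at this
    exact_mod_cast this
  have hmin : minTreeOrder ({1, 0} ∪ Set.range x) = M.card := hleast.csInf_eq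
  rw [hmin]
  refine ⟨hleast, hcard, ?_⟩
  intro V _ S _ hS
  refine (S.order_bound hx hinj hS.1).2 ?_
  rw [hS.2, hmin, hcard]
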